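/- Let $K$ be a field and let $q\in K$, $q\neq 0$, be such that for $n\in\mathbb Z$ one has $\{n\}_q=0$ if and only if $n=0$, where $\{n\}_q=\frac{q^n-1}{q-1}$ if $q\neq 1$ and $\{n\}_q=n$ if $q=1$. Let $H_K(q)$ be the unital associative $K$-algebra generated by $A,B$ subject to $AB-qBA=1$. Every element of $H_K(q)$ can be written uniquely as $\sum_j p_j(B)A^j$ with $p_j\in K[X]$; if it is non-zero, its order is the largest $j$ with $p_j\neq 0$. Let $P=\sum_{j=0}^m p_j(B)A^j$ and $Q=\sum_{j=0}^n q_j(B)A^j$ be commuting elements of $H_K(q)$ of orders $m\geq 1$ and $n\geq 1$, so that $p_m\neq0$ and $q_n\neq 0$. Write $A^kP=\sum_{j=0}^{m+k}p_{k,j}(B)A^j$ for $0\leq k\leq n-1$ and $A^lQ=\sum_{j=0}^{n+l}q_{l,j}(B)A^j$ for $0\leq l\leq m-1$. The eliminant $\Delta=\Delta_{P,Q}(X,\lambda,\mu)\in K[X,\lambda,\mu]$ is the determinant of the $(m+n)\times(m+n)$ matrix, with columns indexed by $j=0,\ldots,m+n-1$, whose first $n$ rows are $(p_{k,j}(X)-\lambda\,\delta_{k,j})_{j}$,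 $k=0,\ldots,n-1$, and whose last $m$ rows are $(q_{l,j}(X)-\mu\,\delta_{l,j})_j$, $l=0,\ldots,m-1$, where $\delta_{a,b}$ is the Kronecker symbol and entries that are not defined above are $0$. Put $$s=n\max_j\deg p_j+m\max_j\deg q_j,\qquad t=\tfrac12 n(n-1)\max_j\deg p_j+\tfrac12 m(m-1)\max_j\deg q_j ,$$ where the maxima are taken over the non-zero $p_j$ and $q_j$. Then $\Delta\neq0$. In fact, $\Delta$ has degree $n$ as an element of $K[X,\mu][\lambda]$, and its non-zero coefficient of $\lambda^n$ is $(-1)^n\prod_{k=0}^{m-1}q_n(q^kX)$; it has degree $m$ as an element of $K[X,\lambda][\mu]$, and its non-zero coefficient of $\mu^m$ is $(-1)^{m(n+1)}\prod_{k=0}^{n-1}p_m(q^kX)$; and it has degree at most $s$ as an element of $K[\lambda,\mu][X]$. Write $\Delta=\sum_{i=0}^s\delta_i(\lambda,\mu)X^i$ with $\delta_i\in K[\lambda,\mu]$. Then: 1. Let $R$ be any subring of $K$ that contains the coefficients of all $p_j$ and $q_j$ (for example the subring generated by these coefficients, or the subring generated by the coefficients of all $p_{k,j}$ and $q_{l,j}$).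 Then $\delta_i\in R[q][\lambda,\mu]$ for $i=0,\ldots,s$, and each coefficient of $\delta_i$ can be written as $\sum_{l=0}^t r_lq^l$ with $r_0,\ldots,r_t\in R$. 2. At least one of $\delta_0,\ldots,\delta_s$ is non-zero. 3. $\delta_i(P,Q)=0$ for all $i=0,\ldots,s$. -/

import Mathlib

noncomputable section

/-- The relation `A B = q B A + 1` on the free algebra on `A = ι 0` and `B = ι 1`. -/
inductive QHeisRel (K : Type*) [Field K] (q : K) :
    FreeAlgebra K (Fin 2) → FreeAlgebra K (Fin 2) → Prop
  | comm : QHeisRel K q (FreeAlgebra.ι K 0 * FreeAlgebra.ι K 1)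
      (q • (FreeAlgebra.ι K 1 * FreeAlgebra.ι K 0) + 1)

/-- The `q`-deformed Heisenberg algebra `H_K(q)`: the unital associative `K`-algebra generated by
`A` and `B` subject to `A B - q B A = 1`. -/
def QHeis (K : Type*) [Field K] (q : K) : Type _ := RingQuot (QHeisRel K q)

namespace QHeis

variable {K : Type*} [Field K] {q : K}

instance : Ring (QHeis K q) := inferInstanceAs (Ring (RingQuot (QHeisRel K q)))

instance : Algebra K (QHeis K q) := inferInstanceAs (Algebra K (RingQuot (QHeisRel K q)))

/-- The quotient map from the free algebra. -/
def mk : FreeAlgebra K (Fin 2) →ₐ[K] QHeis K q := RingQuot.mkAlgHom K (QHeisRel K q)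

/-- The generator `A` of `H_K(q)`. -/
def A : QHeis K q := mk (FreeAlgebra.ι K 0)

/-- The generator `B` of `H_K(q)`. -/
def B : QHeis K q := mk (FreeAlgebra.ι K 1)

theorem A_mul_B : (A * B : QHeis K q) = q • (B * A) + 1 := by
  have h : (mk _ : QHeis K q) = mk _ := RingQuot.mkAlgHom_rel K QHeisRel.comm
  simp only [map_mul, map_add, map_smul, map_one] at h
  exact h

/-- For a family `p = ∑ p_j Y^j` of polynomials `p_j ∈ K[X]`, the element
`∑ p_j(B) A^j` of `H_K(q)`. -/
def ofCoeffs : Polynomial (Polynomial K) →ₗ[K] QHeis K q where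
  toFun f := f.sum fun j p => Polynomial.aeval (B : QHeis K q) p * A ^ j
  map_add' f g := Polynomial.sum_add_index _ _ _ (fun _ => by simp)
    (fun _ _ _ => by simp [add_mul])
  map_smul' c f := by
    rw [Polynomial.sum_smul_index' _ _ _ (fun _ => by simp), RingHom.id_apply,
      Polynomial.sum_def, Polynomial.sum_def, Finset.smul_sum]
    simp

theorem ofCoeffs_monomial (i j : ℕ) (c : K) :
    (ofCoeffs (Polynomial.monomial j (Polynomial.monomial i c)) : QHeis K q)
      = c • (B ^ i * A ^ j) := by
  change Polynomial.sum (Polynomial.monomial j (Polynomial.monomial i c))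
    (fun j p => Polynomial.aeval (B : QHeis K q) p * A ^ j) = _
  rw [Polynomial.sum_monomial_index _ _ (by simp), Polynomial.aeval_monomial,
    ← Algebra.smul_def, smul_mul_assoc]

/-- The action of `A` on the span of the symbols `B ^ i A ^ j`. -/
def actA (q : K) : (ℕ × ℕ →₀ K) →ₗ[K] (ℕ × ℕ →₀ K) :=
  Finsupp.linearCombination K fun ij : ℕ × ℕ => q ^ ij.1 • Finsupp.single (ij.1, ij.2 + 1) 1 +
    (∑ l ∈ Finset.range ij.1, q ^ l) • Finsupp.single (ij.1 - 1, ij.2) 1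

/-- The action of `B` on the span of the symbols `B ^ i A ^ j`. -/
def actB : (ℕ × ℕ →₀ K) →ₗ[K] (ℕ × ℕ →₀ K) :=
  Finsupp.linearCombination K fun ij : ℕ × ℕ => Finsupp.single (ij.1 + 1, ij.2) 1

theorem actA_single (i j : ℕ) : actA q (Finsupp.single (i, j) 1) =
    q ^ i • Finsupp.single (i, j + 1) 1 +
    (∑ l ∈ Finset.range i, q ^ l) • Finsupp.single (i - 1, j) 1 := by
  simp only [actA, Finsupp.linearCombination_single, one_smul]

theorem actB_single (i j : ℕ) : actB (Finsupp.single (i, j) (1 : K)) =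
    Finsupp.single (i + 1, j) 1 := by
  simp only [actB, Finsupp.linearCombination_single, one_smul]

theorem act_rel : actA q * actB = q • (actB * actA q) + 1 := by
  refine Finsupp.lhom_ext' fun ij => LinearMap.ext_ring ?_
  obtain ⟨i, j⟩ := ij
  simp only [LinearMap.comp_apply, Finsupp.lsingle_apply, Module.End.mul_apply,
    LinearMap.add_apply, LinearMap.smul_apply, Module.End.one_apply, actB_single, actA_single,
    map_add, map_smul]
  rcases i with _ | i
  · simp
  · rw [Finset.sum_range_succ' _ (i + 1), show i + 1 + 1 - 1 = i + 1 from rfl,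
      show i + 1 - 1 + 1 = i + 1 from rfl, pow_succ' q (i + 1)]
    simp only [smul_add, smul_smul, pow_zero, add_smul, one_smul, Finset.mul_sum, pow_succ' q,
      add_assoc]

/-- The representation of `H_K(q)` on the span of the symbols `B ^ i A ^ j`. -/
def act : QHeis K q →ₐ[K] Module.End K (ℕ × ℕ →₀ K) :=
  RingQuot.liftAlgHom K ⟨FreeAlgebra.lift K ![actA q, actB], by
    rintro _ _ ⟨⟩
    simpa using act_rel⟩

theorem act_A : act (A : QHeis K q) = actA q := by
  refine (RingQuot.liftAlgHom_mkAlgHom_apply K _ _ _).trans ?_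
  simp

theorem act_B : act (B : QHeis K q) = actB := by
  refine (RingQuot.liftAlgHom_mkAlgHom_apply K _ _ _).trans ?_
  simp

theorem act_monomial (i j : ℕ) : act (B ^ i * A ^ j : QHeis K q) (Finsupp.single (0, 0) 1) =
    Finsupp.single (i, j) 1 := by
  have hA : (actA q ^ j) (Finsupp.single (0, 0) 1) = Finsupp.single (0, j) 1 := by
    induction j with
    | zero => simp
    | succ j ih => rw [pow_succ', Module.End.mul_apply, ih, actA_single]; simp
  rw [map_mul, map_pow, map_pow, act_A, act_B, Module.End.mul_apply, hA]
  induction i with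
  | zero => simp
  | succ i ih => rw [pow_succ', Module.End.mul_apply, ih, actB_single]

theorem act_ofCoeffs (f : Polynomial (Polynomial K)) (i j : ℕ) :
    act (ofCoeffs f : QHeis K q) (Finsupp.single (0, 0) 1) (i, j) = (f.coeff j).coeff i := by
  induction f using Polynomial.induction_on' with
  | add f g hf hg => simp [hf, hg]
  | monomial b p =>
    induction p using Polynomial.induction_on' with
    | add f g hf hg => rw [map_add]; simp [hf, hg]
    | monomial a c =>
      rw [ofCoeffs_monomial, map_smul, LinearMap.smul_apply, act_monomial]
      simp only [Finsupp.smul_apply, Finsupp.single_apply, Polynomial.coeff_monomial,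
        Prod.mk.injEq, smul_eq_mul]
      by_cases h1 : b = j <;> by_cases h2 : a = i <;> simp [h1, h2, Polynomial.coeff_monomial]

theorem mem_range (i j : ℕ) : (B ^ i * A ^ j : QHeis K q) ∈ LinearMap.range ofCoeffs :=
  ⟨Polynomial.monomial j (Polynomial.monomial i 1), by rw [ofCoeffs_monomial, one_smul]⟩

theorem mul_mem_range (a : QHeis K q)
    (h : ∀ i j : ℕ, a * (B ^ i * A ^ j) ∈ LinearMap.range (ofCoeffs (q := q)))
    (x : QHeis K q) (hx : x ∈ LinearMap.range (ofCoeffs (q := q))) :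
    a * x ∈ LinearMap.range (ofCoeffs (q := q)) := by
  obtain ⟨f, rfl⟩ := hx
  induction f using Polynomial.induction_on' with
  | add f g hf hg => rw [map_add, mul_add]; exact add_mem hf hg
  | monomial b p =>
    induction p using Polynomial.induction_on' with
    | add f g hf hg => rw [map_add, map_add, mul_add]; exact add_mem hf hg
    | monomial c d =>
      rw [ofCoeffs_monomial, mul_smul_comm]; exact Submodule.smul_mem _ _ (h _ _)

theorem B_mul_mem_range (x : QHeis K q) (hx : x ∈ LinearMap.range (ofCoeffs (q := q))) :
    B * x ∈ LinearMap.range (ofCoeffs (q := q)) :=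
  mul_mem_range B (fun i j => by rw [← mul_assoc, ← pow_succ']; exact mem_range _ _) x hx

theorem A_mul_mem_range (x : QHeis K q) (hx : x ∈ LinearMap.range (ofCoeffs (q := q))) :
    A * x ∈ LinearMap.range (ofCoeffs (q := q)) := by
  refine mul_mem_range A (fun i j => ?_) x hx
  induction i with
  | zero => simpa [pow_succ'] using mem_range (K := K) (q := q) 0 (j + 1)
  | succ i ih =>
    have : (A * (B ^ (i + 1) * A ^ j) : QHeis K q)
        = q • (B * (A * (B ^ i * A ^ j))) + B ^ i * A ^ j := by
      rw [pow_succ', mul_assoc B, ← mul_assoc A, A_mul_B, add_mul, one_mul, smul_mul_assoc,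
        mul_assoc B]
    rw [this]
    exact add_mem (Submodule.smul_mem _ _ (B_mul_mem_range _ ih)) (mem_range _ _)

/-- The powers of `A` form a basis of `H_K(q)` as a left `K[X]`-module, where `X` acts as left
multiplication with `B`. -/
theorem ofCoeffs_bijective : Function.Bijective (ofCoeffs (K := K) (q := q)) := by
  constructor
  · intro f g h
    ext j i
    rw [← act_ofCoeffs (q := q), h, act_ofCoeffs]
  · intro x
    obtain ⟨y, rfl⟩ := RingQuot.mkAlgHom_surjective K (QHeisRel K q) x
    suffices h : ∀ z : QHeis K q, z ∈ LinearMap.range (ofCoeffs (q := q)) →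
        (mk y : QHeis K q) * z
          ∈ LinearMap.range (ofCoeffs (q := q)) by
      have h1 := h 1 (by simpa using mem_range (K := K) (q := q) 0 0)
      rw [mul_one] at h1
      exact h1
    induction y using FreeAlgebra.induction with
    | grade0 r =>
      intro z hz
      rw [AlgHom.commutes, ← Algebra.smul_def]
      exact Submodule.smul_mem _ _ hz
    | grade1 i =>
      intro z hz
      fin_cases i
      · exact A_mul_mem_range z hz
      · exact B_mul_mem_range z hz
    | mul a b ha hb =>
      intro z hz
      rw [map_mul, mul_assoc]
      exact ha _ (hb _ hz)
    | add a b ha hb =>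
      intro z hz
      rw [map_add, add_mul]
      exact add_mem (ha _ hz) (hb _ hz)

/-- The coefficients of an element of `H_K(q)`: `coeffs P = ∑ p_j Y^j`, where the `p_j ∈ K[X]` are
the unique polynomials with `P = ∑ p_j(B) A^j`. -/
def coeffs : QHeis K q ≃ₗ[K] Polynomial (Polynomial K) :=
  (LinearEquiv.ofBijective ofCoeffs ofCoeffs_bijective).symm

/-- The polynomial `p_j ∈ K[X]` in `P = ∑ p_j(B) A^j`. -/
def coeff (P : QHeis K q) (j : ℕ) : Polynomial K := (coeffs P).coeff j

/-- The order of `P`, i.e. the largest `m` with `p_m ≠ 0` in `P = ∑ p_j(B) A^j`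
(and, by convention, `0` for `P = 0`). -/
def order (P : QHeis K q) : ℕ := (coeffs P).natDegree

/-- The maximum of the degrees of the polynomials `p_j` in `P = ∑ p_j(B) A^j`. -/
def maxDeg (P : QHeis K q) : ℕ := (Finset.range (order P + 1)).sup fun j => (coeff P j).natDegree

theorem eq_sum_coeff (P : QHeis K q) :
    P = ∑ j ∈ Finset.range (order P + 1), Polynomial.aeval B (coeff P j) * A ^ j := by
  conv_lhs => rw [← coeffs.symm_apply_apply P]
  change Polynomial.sum (coeffs P) (fun j p => Polynomial.aeval (B : QHeis K q) p * A ^ j) = _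
  rw [Polynomial.sum_over_range _ (by simp)]
  rfl

/-- The matrix that defines the eliminant of `P` (of order `m`) and `Q` (of order `n`), with rows
and columns numbered from `0` to `m + n - 1`, over the polynomial ring in the variables
`X = X 0`, `λ = X 1` and `μ = X 2`. For `k < n`, row `k` consists of the coefficients of
`A ^ k * P - λ * A ^ k` at the increasing powers of `A`; for `l < m`, row `n + l` consists of those
of `A ^ l * Q - μ * A ^ l`. -/
def eliminantMatrix (P Q : QHeis K q) :
    Matrix (Fin (order P + order Q)) (Fin (order P + order Q)) (MvPolynomial (Fin 3) K) :=
  Matrix.of fun i j =>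
    if (i : ℕ) < order Q then
      Polynomial.aeval (MvPolynomial.X 0) (coeff (A ^ (i : ℕ) * P) j)
        - (if (j : ℕ) = i then MvPolynomial.X 1 else 0)
    else
      Polynomial.aeval (MvPolynomial.X 0) (coeff (A ^ ((i : ℕ) - order Q) * Q) j)
        - (if (j : ℕ) = (i : ℕ) - order Q then MvPolynomial.X 2 else 0)

/-- The eliminant `Δ_{P,Q}(X, λ, μ)` as an element of `K[X, λ, μ]`. -/
def eliminant (P Q : QHeis K q) : MvPolynomial (Fin 3) K := (eliminantMatrix P Q).det

/-- A polynomial in `X, λ, μ` as an element of `K[λ, μ][X]` (variables of the coefficients: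
`λ = X 0`, `μ = X 1`). -/
def inX : MvPolynomial (Fin 3) K →ₐ[K] Polynomial (MvPolynomial (Fin 2) K) :=
  MvPolynomial.aeval
    ![Polynomial.X, Polynomial.C (MvPolynomial.X 0), Polynomial.C (MvPolynomial.X 1)]

/-- A polynomial in `X, λ, μ` as an element of `K[X, μ][λ]` (variables of the coefficients:
`X = X 0`, `μ = X 1`). -/
def inLambda : MvPolynomial (Fin 3) K →ₐ[K] Polynomial (MvPolynomial (Fin 2) K) :=
  MvPolynomial.aeval
    ![Polynomial.C (MvPolynomial.X 0), Polynomial.X, Polynomial.C (MvPolynomial.X 1)]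

/-- A polynomial in `X, λ, μ` as an element of `K[X, λ][μ]` (variables of the coefficients:
`X = X 0`, `λ = X 1`). -/
def inMu : MvPolynomial (Fin 3) K →ₐ[K] Polynomial (MvPolynomial (Fin 2) K) :=
  MvPolynomial.aeval
    ![Polynomial.C (MvPolynomial.X 0), Polynomial.C (MvPolynomial.X 1), Polynomial.X]

/-- The polynomials `δ_i ∈ K[λ, μ]` with `Δ_{P,Q} = ∑ δ_i(λ, μ) X ^ i`. -/
def delta (P Q : QHeis K q) (i : ℕ) : MvPolynomial (Fin 2) K := (inX (eliminant P Q)).coeff i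

/-- The value `δ(P, Q)` of `δ ∈ K[λ, μ]` at commuting elements `P, Q` of `H_K(q)`. -/
def evalAt (δ : MvPolynomial (Fin 2) K) (P Q : QHeis K q) : QHeis K q :=
  ∑ d ∈ δ.support, δ.coeff d • (P ^ d 0 * Q ^ d 1)

/-- The subring of `K` generated by the coefficients of the polynomials `p_j` and `q_j` in
`P = ∑ p_j(B) A^j` and `Q = ∑ q_j(B) A^j`. -/
def coeffRing (P Q : QHeis K q) : Subring K :=
  Subring.closure {c | ∃ j i : ℕ, c = (coeff P j).coeff i ∨ c = (coeff Q j).coeff i}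

end QHeis

open Classical in
/-- The `q`-integer `{n}_q` for an integer `n`. -/
def qInt {K : Type*} [Field K] (q : K) (n : ℤ) : K :=
  if q = 1 then (n : K) else (q ^ n - 1) / (q - 1)

end

/-!
Let `P` and `Q` be commuting elements of orders `m` and `n`. The algebra `K[X, λ, μ]` acts on
`H_K(q)`, with `X` acting as left multiplication by `B`, and `λ`, `μ` as right multiplication by `P`,
`Q`. For this action the eliminant matrix annihilates the vector `(1, A, …, A ^ (m + n - 1))`, because
its rows hold the coefficients of `A ^ k P - λ A ^ k` and `A ^ l Q - μ A ^ l`. By Cramer's rule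
(`Matrix.algHom_det_apply_eq_zero`) its determinant annihilates `1`, which says that
`∑ B ^ i δ_i(P, Q) = 0` (`sum_B_pow_mul_evalAt_delta`).

The `δ_i(P, Q)` commute with `P`. If a non-zero `c` of order `k` commutes with `P`, then
`m * deg c_k = k * deg p_m` for the leading coefficients (`order_mul_natDegree_of_commute`); this is
where the condition on `q` enters. So the degree of `c_k` depends only on `k`, and the elements
`B ^ i c_i`, with the `c_i ≠ 0` commuting with `P`, have pairwise different pairs of order and degree
of the leading coefficient. Hence they cannot sum to zero (`eq_zero_of_sum_B_pow_mul_eq_zero`), and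
every `δ_i(P, Q)` vanishes.

The remaining claims come from bounds for the rows of the eliminant matrix. With respect to each of
`λ`, `μ`, `X` and `q`, the degree of the determinant is at most the sum of the degrees of the rows, and
the top coefficients in `λ` and `μ` are determinants of matrices that are triangular, up to a
permutation of the rows.
-/

namespace QHeis

open Polynomial

variable {K : Type*} [Field K] {q : K}

/-! ### Left multiplication by `A` and `B` in terms of coefficients -/

/-- The dilation `p(X) ↦ p(c X)`. -/
noncomputable def dilate (c : K) : K[X] →ₐ[K] K[X] := Polynomial.aeval (C c * X)

/-- The `q`-derivative, i.e. the linear map `X ^ i ↦ {i}_q X ^ (i - 1)`. It is given by the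
geometric sums `{i}_q = 1 + q + ⋯ + q ^ (i - 1)`, so that `q = 1` needs no separate treatment. -/
noncomputable def qDeriv (q : K) : K[X] →ₗ[K] K[X] :=
  Polynomial.lsum fun i => (∑ l ∈ Finset.range i, q ^ l) • Polynomial.monomial (i - 1)

theorem coeff_dilate (c : K) (p : K[X]) (i : ℕ) : (dilate c p).coeff i = c ^ i * p.coeff i := by
  rw [dilate, ← Polynomial.comp_eq_aeval, comp_C_mul_X_coeff, mul_comm]

theorem dilate_dilate (c d : K) (p : K[X]) : dilate c (dilate d p) = dilate (c * d) p := by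
  ext i
  simp only [coeff_dilate, mul_pow, mul_assoc]

theorem dilate_one (p : K[X]) : dilate 1 p = p := by
  ext i
  simp [coeff_dilate]

theorem dilate_ne_zero {c : K} (hc : c ≠ 0) {p : K[X]} (hp : p ≠ 0) : dilate c p ≠ 0 := by
  contrapose! hp
  ext i
  have h := coeff_dilate c p i
  rw [hp, coeff_zero] at h
  simpa [hc] using h.symm

theorem natDegree_dilate_le (c : K) (p : K[X]) : (dilate c p).natDegree ≤ p.natDegree :=
  natDegree_le_iff_coeff_eq_zero.2 fun i hi => by
    rw [coeff_dilate, coeff_eq_zero_of_natDegree_lt hi, mul_zero]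

theorem aeval_dilate {S : Type*} [CommRing S] [Algebra K S] (c : K) (x : S) (p : K[X]) :
    Polynomial.aeval x (dilate c p) = Polynomial.aeval (algebraMap K S c * x) p := by
  rw [dilate, ← Polynomial.comp_eq_aeval, aeval_comp]
  simp

theorem qDeriv_monomial (i : ℕ) (a : K) : qDeriv q (Polynomial.monomial i a) =
    (∑ l ∈ Finset.range i, q ^ l) • Polynomial.monomial (i - 1) a := by
  simp [qDeriv, Polynomial.lsum_apply, Polynomial.sum_monomial_index]

theorem coeff_qDeriv (p : K[X]) (i : ℕ) :
    (qDeriv q p).coeff i = (∑ l ∈ Finset.range (i + 1), q ^ l) * p.coeff (i + 1) := by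
  induction p using Polynomial.induction_on' with
  | add f g hf hg => rw [map_add, coeff_add, hf, hg, coeff_add, mul_add]
  | monomial j a =>
    rw [qDeriv_monomial, coeff_smul, smul_eq_mul, coeff_monomial, coeff_monomial]
    rcases j with _ | j
    · simp
    · by_cases h : j = i <;> simp [h]

theorem natDegree_qDeriv_le (p : K[X]) : (qDeriv q p).natDegree ≤ p.natDegree :=
  natDegree_le_iff_coeff_eq_zero.2 fun i hi => by
    rw [coeff_qDeriv, coeff_eq_zero_of_natDegree_lt (by omega), mul_zero]

theorem qDeriv_one_eq_derivative (p : K[X]) : qDeriv 1 p = derivative p := by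
  ext i
  simp [coeff_qDeriv, coeff_derivative, mul_comm]

theorem A_mul_aeval_B (p : K[X]) : (A * Polynomial.aeval B p : QHeis K q) =
    Polynomial.aeval B (dilate q p) * A + Polynomial.aeval B (qDeriv q p) := by
  induction p using Polynomial.induction_on' with
  | add f g hf hg => simp only [map_add, mul_add, add_mul, hf, hg]; abel
  | monomial i a =>
    have key : ∀ i : ℕ, (A * B ^ i : QHeis K q) =
        q ^ i • (B ^ i * A) + (∑ l ∈ Finset.range i, q ^ l) • B ^ (i - 1) := by
      intro i
      induction i with
      | zero => simp
      | succ i ih =>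
        rw [pow_succ, ← mul_assoc, ih, add_mul, smul_mul_assoc, mul_assoc, A_mul_B]
        rcases i with _ | i
        · simp
        · rw [Finset.sum_range_succ _ (i + 1), smul_mul_assoc, Nat.add_sub_cancel, ← pow_succ,
            Nat.add_sub_cancel, mul_add, mul_smul_comm, smul_add, smul_smul, mul_one, add_smul,
            ← pow_succ, ← mul_assoc]
          abel
    have h1 : dilate q (Polynomial.monomial i a) = Polynomial.monomial i (q ^ i * a) := by
      ext j
      rw [coeff_dilate, coeff_monomial, coeff_monomial]
      split_ifs with h <;> simp [h]
    rw [h1, qDeriv_monomial, map_smul, aeval_monomial, aeval_monomial, aeval_monomial,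
      ← Algebra.smul_def, ← Algebra.smul_def, ← Algebra.smul_def, mul_smul_comm, key,
      smul_mul_assoc, smul_add, smul_smul, mul_comm a, smul_comm a]

theorem coeffs_ofCoeffs (f : K[X][X]) : coeffs (ofCoeffs f : QHeis K q) = f :=
  (LinearEquiv.ofBijective (ofCoeffs (K := K) (q := q)) ofCoeffs_bijective).symm_apply_apply f

theorem exists_ofCoeffs (P : QHeis K q) : ∃ f, ofCoeffs f = P := ofCoeffs_bijective.2 P

theorem coeff_ofCoeffs (f : K[X][X]) (j : ℕ) : coeff (ofCoeffs f : QHeis K q) j = f.coeff j := by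
  rw [coeff, coeffs_ofCoeffs]

theorem ofCoeffs_monomial_eq (j : ℕ) (p : K[X]) :
    (ofCoeffs (Polynomial.monomial j p) : QHeis K q) = Polynomial.aeval B p * A ^ j := by
  change Polynomial.sum (Polynomial.monomial j p)
    (fun j p => Polynomial.aeval (B : QHeis K q) p * A ^ j) = _
  rw [Polynomial.sum_monomial_index _ _ (by simp)]

theorem coeff_add (P Q : QHeis K q) (j : ℕ) : coeff (P + Q) j = coeff P j + coeff Q j := by
  simp [coeff]

theorem coeff_zero (j : ℕ) : coeff (0 : QHeis K q) j = 0 := by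
  simp [coeff]

theorem coeff_sum {ι : Type*} (s : Finset ι) (f : ι → QHeis K q) (j : ℕ) :
    coeff (∑ i ∈ s, f i) j = ∑ i ∈ s, coeff (f i) j := by
  simp [coeff]

theorem coeff_aeval_B_mul (p : K[X]) (P : QHeis K q) (j : ℕ) :
    coeff (Polynomial.aeval B p * P) j = p * coeff P j := by
  obtain ⟨f, rfl⟩ := exists_ofCoeffs P
  have : (Polynomial.aeval B p * ofCoeffs f : QHeis K q) = ofCoeffs (C p * f) := by
    induction f using Polynomial.induction_on' with
    | add f g hf hg => rw [map_add, mul_add, mul_add, map_add, hf, hg]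
    | monomial i r =>
      rw [C_mul_monomial, ofCoeffs_monomial_eq, ofCoeffs_monomial_eq, map_mul, mul_assoc]
  rw [this, coeff_ofCoeffs, coeff_ofCoeffs, coeff_C_mul]

theorem ofCoeffs_mul_A (f : K[X][X]) : (ofCoeffs f * A : QHeis K q) = ofCoeffs (f * X) := by
  induction f using Polynomial.induction_on' with
  | add f g hf hg => rw [map_add, add_mul, add_mul, map_add, hf, hg]
  | monomial i r =>
    rw [monomial_mul_X, ofCoeffs_monomial_eq, ofCoeffs_monomial_eq, pow_succ, mul_assoc]

theorem coeff_mul_A_succ (P : QHeis K q) (j : ℕ) : coeff (P * A) (j + 1) = coeff P j := by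
  obtain ⟨f, rfl⟩ := exists_ofCoeffs P
  rw [ofCoeffs_mul_A, coeff_ofCoeffs, coeff_ofCoeffs, coeff_mul_X]

theorem coeff_mul_A_zero (P : QHeis K q) : coeff (P * A) 0 = 0 := by
  obtain ⟨f, rfl⟩ := exists_ofCoeffs P
  rw [ofCoeffs_mul_A, coeff_ofCoeffs, mul_coeff_zero, coeff_X_zero, mul_zero]

/-- The commutation rule `A p(B) = p(q B) A + (D_q p)(B)` in terms of coefficients. Writing
`coeff (P * A) j` for the coefficient of `P` at `j - 1` covers `j = 0`. -/
theorem coeff_A_mul (P : QHeis K q) (j : ℕ) :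
    coeff (A * P) j = dilate q (coeff (P * A) j) + qDeriv q (coeff P j) := by
  obtain ⟨f, rfl⟩ := exists_ofCoeffs P
  induction f using Polynomial.induction_on' with
  | add f g hf hg => simp only [map_add, mul_add, add_mul, coeff_add, hf, hg]; abel
  | monomial i p =>
    have : (A * ofCoeffs (Polynomial.monomial i p) : QHeis K q) =
        ofCoeffs (Polynomial.monomial (i + 1) (dilate q p) +
          Polynomial.monomial i (qDeriv q p)) := by
      rw [map_add, ofCoeffs_monomial_eq, ofCoeffs_monomial_eq, ofCoeffs_monomial_eq, ← mul_assoc,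
        A_mul_aeval_B, add_mul, mul_assoc, ← pow_succ']
    rw [this, ofCoeffs_mul_A, coeff_ofCoeffs, coeff_ofCoeffs, coeff_ofCoeffs, monomial_mul_X,
      Polynomial.coeff_add]
    simp only [coeff_monomial]
    split_ifs <;> simp

theorem coeff_mul (P Q : QHeis K q) (j : ℕ) :
    coeff (P * Q) j = ∑ i ∈ Finset.range (order P + 1), coeff P i * coeff (A ^ i * Q) j := by
  conv_lhs => rw [eq_sum_coeff P, Finset.sum_mul, coeff_sum]
  simp only [mul_assoc, coeff_aeval_B_mul]

/-! ### Coefficients of `A ^ k * P` -/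

theorem coeff_eq_zero_of_order_lt {P : QHeis K q} {j : ℕ} (h : order P < j) : coeff P j = 0 :=
  Polynomial.coeff_eq_zero_of_natDegree_lt h

theorem coeff_order_ne_zero {P : QHeis K q} (h : P ≠ 0) : coeff P (order P) ≠ 0 :=
  Polynomial.leadingCoeff_ne_zero.2 (by simpa using h)

theorem natDegree_coeff_le (P : QHeis K q) (j : ℕ) : (coeff P j).natDegree ≤ maxDeg P := by
  by_cases h : j ≤ order P
  · exact Finset.le_sup (f := fun j => (coeff P j).natDegree)
      (Finset.mem_range.2 (Nat.lt_succ_of_le h))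
  · rw [coeff_eq_zero_of_order_lt (not_le.1 h), natDegree_zero]
    exact Nat.zero_le _

theorem coeff_A_pow_mul_eq_zero (P : QHeis K q) (k : ℕ) {j : ℕ} (h : order P + k < j) :
    coeff (A ^ k * P) j = 0 := by
  induction k generalizing j with
  | zero => rw [pow_zero, one_mul]; exact coeff_eq_zero_of_order_lt h
  | succ k ih =>
    obtain ⟨j, rfl⟩ := Nat.exists_eq_succ_of_ne_zero (Nat.ne_of_gt (Nat.zero_lt_of_lt h))
    rw [pow_succ', mul_assoc, coeff_A_mul, coeff_mul_A_succ, ih (by omega), ih (by omega),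
      map_zero, map_zero, add_zero]

theorem coeff_A_pow_mul_top (P : QHeis K q) (k : ℕ) :
    coeff (A ^ k * P) (order P + k) = dilate (q ^ k) (coeff P (order P)) := by
  induction k with
  | zero => simp [dilate_one]
  | succ k ih =>
    rw [pow_succ', mul_assoc, coeff_A_mul, ← add_assoc, coeff_mul_A_succ, ih,
      coeff_A_pow_mul_eq_zero P k (by omega), map_zero, add_zero, dilate_dilate, pow_succ']

theorem natDegree_coeff_A_pow_mul_le (P : QHeis K q) (k j : ℕ) :
    (coeff (A ^ k * P) j).natDegree ≤ maxDeg P := by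
  induction k generalizing j with
  | zero => rw [pow_zero, one_mul]; exact natDegree_coeff_le P j
  | succ k ih =>
    rw [pow_succ', mul_assoc, coeff_A_mul]
    refine (natDegree_add_le _ _).trans (max_le ?_ ((natDegree_qDeriv_le _).trans (ih _)))
    refine (natDegree_dilate_le _ _).trans ?_
    rcases j with _ | j
    · simp [coeff_mul_A_zero]
    · rw [coeff_mul_A_succ]; exact ih _

theorem coeff_mul_top (P Q : QHeis K q) : coeff (P * Q) (order Q + order P) =
    coeff P (order P) * dilate (q ^ order P) (coeff Q (order Q)) := by
  rw [coeff_mul, Finset.sum_range_succ, Finset.sum_eq_zero, zero_add, coeff_A_pow_mul_top]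
  intro i hi
  rw [coeff_A_pow_mul_eq_zero Q i (by have := Finset.mem_range.1 hi; omega), mul_zero]

/-- For `q = 1`, the second highest coefficient of `A ^ k * P`. The factor `A` on the right shifts
the indices by `1`, which keeps them non-negative. -/
theorem coeff_A_pow_mul_mul_A_top (P : QHeis K 1) (k : ℕ) :
    coeff (A ^ k * P * A) (order P + k) =
      coeff (P * A) (order P) + (k : K[X]) * derivative (coeff P (order P)) := by
  induction k with
  | zero => simp
  | succ k ih =>
    have h := coeff_A_pow_mul_top P k
    rw [one_pow, dilate_one] at h
    rw [← add_assoc, coeff_mul_A_succ, pow_succ', mul_assoc, coeff_A_mul, ih, h, dilate_one,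
      qDeriv_one_eq_derivative]
    push_cast
    ring

/-- For `q = 1`, the second highest coefficient of a product. -/
theorem coeff_mul_mul_A_top (P Q : QHeis K 1) :
    coeff (P * Q * A) (order Q + order P) =
      coeff P (order P) * (coeff (Q * A) (order Q) +
        (order P : K[X]) * derivative (coeff Q (order Q))) +
        coeff (P * A) (order P) * coeff Q (order Q) := by
  rw [mul_assoc, coeff_mul, Finset.sum_range_succ, add_comm, ← mul_assoc,
    coeff_A_pow_mul_mul_A_top]
  congr 1
  cases hk : order P with
  | zero => simp [coeff_mul_A_zero]
  | succ k =>
    rw [Finset.sum_range_succ, ← add_assoc, ← mul_assoc, coeff_mul_A_succ, coeff_mul_A_succ,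
      coeff_A_pow_mul_top, one_pow, dilate_one, Finset.sum_eq_zero, zero_add]
    intro i hi
    rw [← mul_assoc, coeff_mul_A_succ,
      coeff_A_pow_mul_eq_zero Q i (by have := Finset.mem_range.1 hi; omega), mul_zero]

/-! ### Leading coefficients of commuting elements -/

theorem coeff_X_mul_derivative (p : K[X]) (i : ℕ) :
    (X * derivative p).coeff i = i * p.coeff i := by
  rcases i with _ | i
  · simp
  · rw [Polynomial.coeff_X_mul, coeff_derivative]
    push_cast
    ring

/-- Leading coefficients `p` and `c` of commuting elements of orders `m` and `k` satisfy
`m * deg c = k * deg p`. For `q ≠ 1` this follows on comparing the leading coefficients in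
`p(X) c(q ^ m X) = c(X) p(q ^ k X)`, and for `q = 1` on comparing those in
`m p c' = k c p'`, which comes from the second highest coefficients of the products. -/
theorem order_mul_natDegree_of_commute (hq : q ≠ 0) (hqInt : ∀ n : ℤ, qInt q n = 0 ↔ n = 0)
    {P Q : QHeis K q} (hP : P ≠ 0) (hQ : Q ≠ 0) (h : Commute P Q) :
    order P * (coeff Q (order Q)).natDegree = order Q * (coeff P (order P)).natDegree := by
  have hp := leadingCoeff_ne_zero.2 (coeff_order_ne_zero hP)
  have hc := leadingCoeff_ne_zero.2 (coeff_order_ne_zero hQ)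
  set p := coeff P (order P) with hp'
  set c := coeff Q (order Q) with hc'
  rw [← Nat.cast_inj (R := ℤ), ← sub_eq_zero, ← hqInt]
  by_cases hq1 : q = 1
  · subst hq1
    -- The terms without derivatives cancel. Multiplication with `X` makes the degrees of `X p'` and
    -- `X c'` those of `p` and `c`, also if `p` or `c` is constant.
    have h1 := coeff_mul_mul_A_top P Q
    rw [h.eq, add_comm, coeff_mul_mul_A_top, ← hp', ← hc'] at h1
    have h2 : c * ((order Q : K[X]) * (X * derivative p)) =
        p * ((order P : K[X]) * (X * derivative c)) := by
      linear_combination X * h1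
    have bound (k : ℕ) (f : K[X]) : ((k : K[X]) * (X * derivative f)).natDegree ≤ f.natDegree := by
      refine natDegree_le_iff_coeff_eq_zero.2 fun i hi => ?_
      rw [← C_eq_natCast, coeff_C_mul, coeff_X_mul_derivative, coeff_eq_zero_of_natDegree_lt hi,
        mul_zero, mul_zero]
    have h3 := congrArg (fun f => Polynomial.coeff f (c.natDegree + p.natDegree)) h2
    rw [coeff_mul_add_eq_of_natDegree_le le_rfl (bound _ _), add_comm c.natDegree,
      coeff_mul_add_eq_of_natDegree_le le_rfl (bound _ _)] at h3
    simp only [← C_eq_natCast, coeff_C_mul, coeff_X_mul_derivative, coeff_natDegree] at h3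
    rw [qInt, if_pos rfl]
    push_cast
    refine mul_left_cancel₀ (mul_ne_zero hp hc) ?_
    linear_combination -h3
  · have h1 := coeff_mul_top P Q
    rw [h.eq, add_comm, coeff_mul_top, ← hp', ← hc'] at h1
    have h3 := congrArg (fun f => Polynomial.coeff f (c.natDegree + p.natDegree)) h1
    rw [coeff_mul_add_eq_of_natDegree_le le_rfl (natDegree_dilate_le _ _), add_comm c.natDegree,
      coeff_mul_add_eq_of_natDegree_le le_rfl (natDegree_dilate_le _ _)] at h3
    simp only [coeff_dilate, coeff_natDegree, ← pow_mul] at h3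
    have h4 : q ^ (order P * c.natDegree) = q ^ (order Q * p.natDegree) := by
      refine mul_left_cancel₀ (mul_ne_zero hp hc) ?_
      linear_combination -h3
    rw [qInt, if_neg hq1, zpow_sub₀ hq, zpow_natCast, zpow_natCast, h4,
      div_self (pow_ne_zero _ hq), sub_self, zero_div]

/-- The powers of `B` are linearly independent over the centralizer of an element `P` of positive
order. By `order_mul_natDegree_of_commute`, the degree of the leading coefficient of a non-zero
element of this centralizer is determined by its order, so the terms `B ^ i * c i` of maximal order
have leading coefficients of different degrees and cannot cancel. -/
theorem eq_zero_of_sum_B_pow_mul_eq_zero (hq : q ≠ 0) (hqInt : ∀ n : ℤ, qInt q n = 0 ↔ n = 0)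
    {P : QHeis K q} (hP : 1 ≤ order P) (s : Finset ℕ) (c : ℕ → QHeis K q)
    (hc : ∀ i ∈ s, Commute P (c i)) (h : ∑ i ∈ s, B ^ i * c i = 0) : ∀ i ∈ s, c i = 0 := by
  classical
  by_contra! hne
  have hP0 : P ≠ 0 := by
    rintro rfl
    simp [order] at hP
  obtain ⟨i₀, hi₀, hmax⟩ := (s.filter fun i => c i ≠ 0).exists_max_image
    (fun i => toLex (order (c i), i)) (by
      obtain ⟨i, hi, h⟩ := hne
      exact ⟨i, Finset.mem_filter.2 ⟨hi, h⟩⟩)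
  rw [Finset.mem_filter] at hi₀
  set j := order (c i₀) with hj
  set d := (coeff (c i₀) j).natDegree with hd
  have h0 : (coeff (∑ i ∈ s, B ^ i * c i) j).coeff (d + i₀) = 0 := by
    rw [h, coeff_zero, Polynomial.coeff_zero]
  have hterm : ∀ i, coeff (B ^ i * c i) j = X ^ i * coeff (c i) j := fun i => by
    rw [← coeff_aeval_B_mul, map_pow, aeval_X]
  rw [coeff_sum, finsetSum_coeff, Finset.sum_eq_single_of_mem i₀ hi₀.1, hterm,
    coeff_X_pow_mul] at h0
  · exact coeff_order_ne_zero hi₀.2 (leadingCoeff_eq_zero.1 h0)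
  · intro i hi hii
    rw [hterm]
    by_cases hci : c i = 0
    · rw [hci, coeff_zero, mul_zero, Polynomial.coeff_zero]
    have hle := hmax i (Finset.mem_filter.2 ⟨hi, hci⟩)
    rw [Prod.Lex.toLex_le_toLex] at hle
    rcases hle with hlt | ⟨heq, hle⟩
    · rw [coeff_eq_zero_of_order_lt hlt, mul_zero, Polynomial.coeff_zero]
    · simp only at heq hle
      have h1 := order_mul_natDegree_of_commute hq hqInt hP0 hci (hc i hi)
      have h2 := order_mul_natDegree_of_commute hq hqInt hP0 hi₀.2 (hc i₀ hi₀.1)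
      rw [heq, ← h2] at h1
      have h3 := Nat.eq_of_mul_eq_mul_left hP h1
      refine coeff_eq_zero_of_natDegree_lt (natDegree_mul_le.trans_lt ?_)
      rw [natDegree_X_pow, h3, ← hj, ← hd]
      omega

/-! ### The action of `K[X, λ, μ]` on `H_K(q)` -/

/-- The universal property of polynomial rings for commuting elements of a non-commutative
algebra. -/
theorem _root_.MvPolynomial.exists_algHom_of_commute {σ R : Type*} [Ring R] [Algebra K R]
    (x : σ → R) (h : ∀ i j, Commute (x i) (x j)) :
    ∃ φ : MvPolynomial σ K →ₐ[K] R, ∀ i, φ (MvPolynomial.X i) = x i := by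
  have hcomm : IsMulCommutative (Algebra.adjoin K (Set.range x)) :=
    Algebra.isMulCommutative_adjoin K (by
      rintro _ ⟨i, rfl⟩ _ ⟨j, rfl⟩
      exact h i j)
  open scoped IsMulCommutative in
  refine ⟨(Algebra.adjoin K (Set.range x)).val.comp (MvPolynomial.aeval fun i =>
    (⟨x i, Algebra.subset_adjoin ⟨i, rfl⟩⟩ : Algebra.adjoin K (Set.range x))), fun i => ?_⟩
  simp

/-- Cramer's rule for a commutative algebra that acts on a vector space: the determinant of a matrix
annihilates every component of a vector in its kernel. -/
theorem _root_.Matrix.algHom_det_apply_eq_zero {S V ι : Type*} [CommRing S] [Algebra K S]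
    [AddCommGroup V] [Module K V] [Fintype ι] [DecidableEq ι] (φ : S →ₐ[K] Module.End K V)
    (M : Matrix ι ι S) (v : ι → V) (h : ∀ i, ∑ j, φ (M i j) (v j) = 0) (j : ι) :
    φ M.det (v j) = 0 := by
  have h1 : ∑ k, φ ((M.adjugate * M) j k) (v k) = 0 := by
    simp only [Matrix.mul_apply, map_sum, LinearMap.sum_apply]
    rw [Finset.sum_comm]
    refine Finset.sum_eq_zero fun i _ => ?_
    simp only [map_mul, Module.End.mul_apply, ← map_sum, h, map_zero]
  rw [Matrix.adjugate_mul, Finset.sum_eq_single j] at h1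
  · simpa using h1
  · intro k _ hk
    simp [Matrix.one_apply_ne hk.symm]
  · simp

/-- For commuting `P` and `Q`, the algebra `K[X, λ, μ]` acts on `H_K(q)`: `X` by left multiplication
with `B`, and `λ` and `μ` by right multiplication with `P` and `Q`. -/
theorem exists_action {P Q : QHeis K q} (h : Commute P Q) :
    ∃ φ : MvPolynomial (Fin 3) K →ₐ[K] Module.End K (QHeis K q),
      φ (MvPolynomial.X 0) = LinearMap.mulLeft K B ∧ φ (MvPolynomial.X 1) = LinearMap.mulRight K P ∧
        φ (MvPolynomial.X 2) = LinearMap.mulRight K Q := by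
  have hl (R : QHeis K q) : Commute (LinearMap.mulLeft K (B : QHeis K q))
      (LinearMap.mulRight K R) := LinearMap.commute_mulLeft_right B R
  have hr : Commute (LinearMap.mulRight K P) (LinearMap.mulRight K Q) :=
    LinearMap.ext fun x => by simp [mul_assoc, h.eq]
  obtain ⟨φ, hφ⟩ := MvPolynomial.exists_algHom_of_commute (K := K)
    ![LinearMap.mulLeft K (B : QHeis K q), LinearMap.mulRight K P, LinearMap.mulRight K Q] (by
      intro i j
      fin_cases i <;> fin_cases j
      exacts [Commute.refl _, hl P, hl Q, (hl P).symm, Commute.refl _, hr, (hl Q).symm, hr.symm,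
        Commute.refl _])
  exact ⟨φ, hφ 0, hφ 1, hφ 2⟩

theorem sum_aeval_B_coeff_mul (P : QHeis K q) {N : ℕ} (h : ∀ j, N ≤ j → coeff P j = 0) :
    ∑ j : Fin N, Polynomial.aeval B (coeff P j) * A ^ (j : ℕ) = P := by
  rw [Fin.sum_univ_eq_sum_range (fun j => Polynomial.aeval (B : QHeis K q) (coeff P j) * A ^ j)]
  conv_rhs => rw [eq_sum_coeff P]
  rcases le_total N (order P + 1) with h1 | h1
  · refine Finset.sum_subset (Finset.range_mono h1) fun j _ hj => ?_
    rw [h j (by simpa using hj), map_zero, zero_mul]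
  · refine (Finset.sum_subset (Finset.range_mono h1) fun j _ hj => ?_).symm
    rw [coeff_eq_zero_of_order_lt (by simpa using hj), map_zero, zero_mul]

/-- The row of the coefficients of `A ^ k * P - λ * A ^ k` annihilates the vector of the powers of
`A`, if `λ` acts as right multiplication with `P`. -/
theorem sum_row_apply (φ : MvPolynomial (Fin 3) K →ₐ[K] Module.End K (QHeis K q))
    (h0 : φ (MvPolynomial.X 0) = LinearMap.mulLeft K B) {P : QHeis K q} {a : Fin 3}
    (ha : φ (MvPolynomial.X a) = LinearMap.mulRight K P) {N k : ℕ} (hN : order P + k < N) :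
    ∑ j : Fin N, φ (Polynomial.aeval (MvPolynomial.X 0) (coeff (A ^ k * P) j)
      - (if (j : ℕ) = k then MvPolynomial.X a else 0)) (A ^ (j : ℕ)) = 0 := by
  have hk : k < N := by omega
  have h1 (p : K[X]) (x : QHeis K q) :
      φ (Polynomial.aeval (MvPolynomial.X 0) p) x = Polynomial.aeval B p * x := by
    rw [← Polynomial.aeval_algHom_apply, h0]
    change (Polynomial.aeval (Algebra.lmul K (QHeis K q) B) p) x = _
    rw [Polynomial.aeval_algHom_apply]
    rfl
  simp only [map_sub, LinearMap.sub_apply, Finset.sum_sub_distrib, h1]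
  rw [sum_aeval_B_coeff_mul _ fun j hj => coeff_A_pow_mul_eq_zero P k (by omega), sub_eq_zero,
    Finset.sum_eq_single ⟨k, hk⟩]
  · simp [ha]
  · intro j _ hj
    rw [if_neg fun h => hj (Fin.ext h), map_zero, LinearMap.zero_apply]
  · simp

/-- The eliminant annihilates `1`: the vector of the powers of `A` is in the kernel of the
eliminant matrix, as row `k` sends it to `A ^ k * P - A ^ k * P` (or to the analogue for `Q`). -/
theorem eliminant_apply_one {P Q : QHeis K q} (hP : 1 ≤ order P)
    (φ : MvPolynomial (Fin 3) K →ₐ[K] Module.End K (QHeis K q))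
    (h0 : φ (MvPolynomial.X 0) = LinearMap.mulLeft K B)
    (h1 : φ (MvPolynomial.X 1) = LinearMap.mulRight K P)
    (h2 : φ (MvPolynomial.X 2) = LinearMap.mulRight K Q) : φ (eliminant P Q) 1 = 0 := by
  have h := Matrix.algHom_det_apply_eq_zero φ (eliminantMatrix P Q) (fun j => A ^ (j : ℕ))
    (fun i => ?_) ⟨0, by omega⟩
  · simpa [eliminant] using h
  · simp only [eliminantMatrix, Matrix.of_apply]
    have hi := i.2
    split_ifs with h
    · exact sum_row_apply φ h0 h1 (by omega)
    · exact sum_row_apply φ h0 h2 (by omega)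

theorem evalAt_eq {P Q : QHeis K q} (h : Commute P Q)
    (φ : MvPolynomial (Fin 2) K →ₐ[K] Module.End K (QHeis K q))
    (h0 : φ (MvPolynomial.X 0) = LinearMap.mulRight K P)
    (h1 : φ (MvPolynomial.X 1) = LinearMap.mulRight K Q) (δ : MvPolynomial (Fin 2) K) :
    evalAt δ P Q = φ δ 1 := by
  conv_rhs => rw [MvPolynomial.as_sum δ]
  rw [evalAt, map_sum, LinearMap.sum_apply]
  refine Finset.sum_congr rfl fun d _ => ?_
  rw [MvPolynomial.monomial_eq, MvPolynomial.C_mul', map_smul, LinearMap.smul_apply,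
    Finsupp.prod_fintype _ _ (fun _ => pow_zero _), Fin.prod_univ_two, map_mul, map_pow, map_pow,
    h0, h1, LinearMap.pow_mulRight, LinearMap.pow_mulRight, Module.End.mul_apply,
    LinearMap.mulRight_apply, LinearMap.mulRight_apply, one_mul, (h.pow_pow _ _).eq]

theorem commute_evalAt {P Q : QHeis K q} (h : Commute P Q) (δ : MvPolynomial (Fin 2) K) :
    Commute P (evalAt δ P Q) :=
  Commute.sum_right _ _ _ fun _ _ =>
    (((Commute.refl P).pow_right _).mul_right (h.pow_right _)).smul_right _

/-- The inverse of `inX`. -/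
noncomputable def ofInX : Polynomial (MvPolynomial (Fin 2) K) →ₐ[K] MvPolynomial (Fin 3) K :=
  Polynomial.eval₂AlgHom (MvPolynomial.aeval ![MvPolynomial.X 1, MvPolynomial.X 2])
    (MvPolynomial.X 0) fun _ => Commute.all _ _

theorem ofInX_inX (f : MvPolynomial (Fin 3) K) : ofInX (inX f) = f := by
  suffices h : ofInX.comp inX = AlgHom.id K (MvPolynomial (Fin 3) K) from DFunLike.congr_fun h f
  refine MvPolynomial.algHom_ext fun i => ?_
  fin_cases i <;> simp [ofInX, inX]

theorem inX_injective : Function.Injective (inX (K := K)) :=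
  Function.LeftInverse.injective ofInX_inX

/-- The identity `eliminant_apply_one`, sorted by the powers of `X`. The factors `B ^ i` end up on the
left, as `X` acts from the left and `λ` and `μ` act from the right. -/
theorem sum_B_pow_mul_evalAt_delta {P Q : QHeis K q} (hP : 1 ≤ order P) (h : Commute P Q) {s : ℕ}
    (hs : (inX (eliminant P Q)).natDegree ≤ s) :
    ∑ i ∈ Finset.range (s + 1), B ^ i * evalAt (delta P Q i) P Q = 0 := by
  obtain ⟨φ, h0, h1, h2⟩ := exists_action h
  rw [← eliminant_apply_one hP φ h0 h1 h2]
  conv_rhs => rw [← ofInX_inX (eliminant P Q), as_sum_range' (inX (eliminant P Q)) (s + 1)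
    (Nat.lt_succ_of_le hs)]
  rw [map_sum, map_sum, LinearMap.sum_apply]
  refine Finset.sum_congr rfl fun i _ => ?_
  rw [evalAt_eq h (φ.comp (MvPolynomial.aeval ![MvPolynomial.X 1, MvPolynomial.X 2]))
    (by simp [h1]) (by simp [h2]), ← C_mul_X_pow_eq_monomial, mul_comm, map_mul, map_pow, map_mul,
    Module.End.mul_apply]
  simp [ofInX, h0, LinearMap.pow_mulLeft, delta]

end QHeis

/-! ### Determinants and filtrations by rows -/

/-- If row `i` of a matrix lies in step `d i` of a multiplicative filtration, then the determinant
lies in step `∑ i, d i`. -/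
theorem Matrix.det_mem_of_forall_row_mem {S ι : Type*} [CommRing S] [Fintype ι] [DecidableEq ι]
    (G : ℕ → AddSubgroup S) (h1 : 1 ∈ G 0)
    (hmul : ∀ a b x y, x ∈ G a → y ∈ G b → x * y ∈ G (a + b)) (M : Matrix ι ι S) (d : ι → ℕ)
    (h : ∀ i j, M i j ∈ G (d i)) : M.det ∈ G (∑ i, d i) := by
  rw [Matrix.det_apply]
  refine sum_mem fun σ _ => ?_
  rw [Units.smul_def]
  refine zsmul_mem ?_ _
  rw [← Equiv.sum_comp σ d]
  induction (Finset.univ : Finset ι) using Finset.induction_on with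
  | empty => simpa using h1
  | insert i s hi ih =>
    rw [Finset.prod_insert hi, Finset.sum_insert hi]
    exact hmul _ _ _ _ (h _ _) ih

namespace Polynomial

theorem natDegree_det_le_of_rows {S ι : Type*} [CommRing S] [Fintype ι] [DecidableEq ι]
    (M : Matrix ι ι S[X]) (d : ι → ℕ) (h : ∀ i j, (M i j).natDegree ≤ d i) :
    M.det.natDegree ≤ ∑ i, d i := by
  have := Matrix.det_mem_of_forall_row_mem (fun n => (degreeLE S n).toAddSubgroup)
    (by simp [mem_degreeLE]) (fun a b x y hx hy => ?_) M d
    (fun i j => by simpa [mem_degreeLE] using natDegree_le_iff_degree_le.1 (h i j))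
  · exact natDegree_le_iff_degree_le.2 (mem_degreeLE.1 this)
  · exact mem_degreeLE.2 (natDegree_le_iff_degree_le.1 (natDegree_mul_le_of_le
      (natDegree_le_iff_degree_le.2 (mem_degreeLE.1 hx))
      (natDegree_le_iff_degree_le.2 (mem_degreeLE.1 hy))))

theorem coeff_prod_of_forall_natDegree_le {S ι : Type*} [CommRing S] (s : Finset ι) (f : ι → S[X])
    (d : ι → ℕ) (h : ∀ i, (f i).natDegree ≤ d i) :
    (∏ i ∈ s, f i).coeff (∑ i ∈ s, d i) = ∏ i ∈ s, (f i).coeff (d i) := by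
  classical
  induction s using Finset.induction_on with
  | empty => simp
  | insert i s hi ih =>
    rw [Finset.prod_insert hi, Finset.sum_insert hi, Finset.prod_insert hi,
      coeff_mul_add_eq_of_natDegree_le (h i)
        ((natDegree_prod_le _ _).trans (Finset.sum_le_sum fun i _ => h i)), ih]

/-- The top coefficient of a determinant with rows of degrees at most `d i` is the determinant of the
top coefficients of the entries. -/
theorem coeff_det_of_rows {S ι : Type*} [CommRing S] [Fintype ι] [DecidableEq ι]
    (M : Matrix ι ι S[X]) (d : ι → ℕ) (h : ∀ i j, (M i j).natDegree ≤ d i) :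
    M.det.coeff (∑ i, d i) = (Matrix.of fun i j => (M i j).coeff (d i)).det := by
  rw [Matrix.det_apply, Matrix.det_apply, finsetSum_coeff]
  refine Finset.sum_congr rfl fun σ _ => ?_
  rw [Units.smul_def, Units.smul_def, coeff_smul, ← Equiv.sum_comp σ d,
    coeff_prod_of_forall_natDegree_le _ _ (fun i => d (σ i)) fun i => h _ _]
  rfl

end Polynomial

@[to_additive]
theorem Fin.prod_univ_ite_lt {M : Type*} [CommMonoid M] {N a b : ℕ} (h : N = a + b) (f g : ℕ → M) :
    ∏ i : Fin N, (if (i : ℕ) < a then f i else g (i - a)) =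
      (∏ k ∈ Finset.range a, f k) * ∏ l ∈ Finset.range b, g l := by
  rw [Fin.prod_univ_eq_prod_range (fun i => if i < a then f i else g (i - a)), h,
    Finset.prod_range_add]
  congr 1
  · exact Finset.prod_congr rfl fun i hi => if_pos (Finset.mem_range.1 hi)
  · exact Finset.prod_congr rfl fun i _ => by simp

theorem sign_finCycle {N : ℕ} (k : Fin N) :
    Equiv.Perm.sign (finCycle k) = (-1) ^ ((N - 1) * (k : ℕ)) := by
  have : finCycle k = finRotate N ^ (k : ℕ) := by
    ext i
    rw [finCycle_eq_finRotate_iterate, Equiv.Perm.iterate_eq_pow]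
  rw [this, map_pow, sign_finRotate, pow_mul]

namespace QHeis

open Polynomial

variable {K : Type*} [Field K] {q : K}

/-! ### Degrees and leading coefficients of the eliminant -/

theorem inLambda_aeval_X (p : K[X]) : inLambda (K := K) (Polynomial.aeval (MvPolynomial.X 0) p) =
    C (Polynomial.aeval (MvPolynomial.X 0) p) := by
  have h : inLambda (MvPolynomial.X 0 : MvPolynomial (Fin 3) K) =
      algebraMap (MvPolynomial (Fin 2) K) _ (MvPolynomial.X 0) := by simp [inLambda]
  rw [← Polynomial.aeval_algHom_apply, h, Polynomial.aeval_algebraMap_apply]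
  rfl

theorem inMu_aeval_X (p : K[X]) : inMu (K := K) (Polynomial.aeval (MvPolynomial.X 0) p) =
    C (Polynomial.aeval (MvPolynomial.X 0) p) := by
  have h : inMu (MvPolynomial.X 0 : MvPolynomial (Fin 3) K) =
      algebraMap (MvPolynomial (Fin 2) K) _ (MvPolynomial.X 0) := by simp [inMu]
  rw [← Polynomial.aeval_algHom_apply, h, Polynomial.aeval_algebraMap_apply]
  rfl

theorem inX_aeval_X (p : K[X]) :
    inX (Polynomial.aeval (MvPolynomial.X 0) p) = p.map MvPolynomial.C := by
  rw [← Polynomial.aeval_algHom_apply]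
  simpa [inX] using Polynomial.aeval_X_left_eq_map (S := MvPolynomial (Fin 2) K) p

/-- The coefficient of `λ ^ n` is the determinant of the matrix with the first `n` rows replaced by
`-1` on the diagonal and `0` elsewhere. This matrix is lower triangular, with the leading coefficients
of the `A ^ l * Q` as its remaining diagonal entries. -/
theorem coeff_inLambda_eliminant {P Q : QHeis K q} (hQ : 1 ≤ order Q) :
    (inLambda (eliminant P Q)).natDegree ≤ order Q ∧
    (inLambda (eliminant P Q)).coeff (order Q) = (-1) ^ order Q * ∏ k ∈ Finset.range (order P),
      Polynomial.aeval (MvPolynomial.C (q ^ k) * MvPolynomial.X 0) (coeff Q (order Q)) := by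
  set M := (eliminantMatrix P Q).map inLambda with hM
  have hM' : ∀ i j, M i j = if (i : ℕ) < order Q then
      C (Polynomial.aeval (MvPolynomial.X 0) (coeff (A ^ (i : ℕ) * P) j))
        - (if (j : ℕ) = i then X else 0)
    else
      C (Polynomial.aeval (MvPolynomial.X 0) (coeff (A ^ ((i : ℕ) - order Q) * Q) j)
        - (if (j : ℕ) = (i : ℕ) - order Q then MvPolynomial.X 1 else 0)) := by
    intro i j
    simp only [hM, Matrix.map_apply, eliminantMatrix, Matrix.of_apply]
    split_ifs <;> simp only [map_sub, inLambda_aeval_X, map_zero] <;> simp [inLambda]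
  have hdet : inLambda (eliminant P Q) = M.det := AlgHom.map_det _ _
  have hdeg : ∀ i j, (M i j).natDegree ≤ if (i : ℕ) < order Q then 1 else 0 := by
    intro i j
    rw [hM']
    split_ifs
    · exact (natDegree_sub_le _ _).trans (max_le (by simp) (by simp))
    · exact (natDegree_sub_le _ _).trans (max_le (by simp) (by simp))
    · simp
    · simp
  have hsum : ∑ i : Fin (order P + order Q), (if (i : ℕ) < order Q then 1 else 0) = order Q := by
    rw [Fin.sum_univ_ite_lt (add_comm _ _) (fun _ => 1) (fun _ => 0)]
    simp
  have h1 := natDegree_det_le_of_rows M _ hdeg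
  have h2 := coeff_det_of_rows M _ hdeg
  rw [hsum] at h1 h2
  rw [hdet]
  refine ⟨h1, ?_⟩
  rw [h2, Matrix.det_of_isLowerTriangular]
  · have hc : (-1) ^ order Q = ∏ _k ∈ Finset.range (order Q),
        (-1 : MvPolynomial (Fin 2) K) := by simp
    rw [hc, ← Fin.prod_univ_ite_lt (add_comm _ _)]
    refine Finset.prod_congr rfl fun i _ => ?_
    rw [Matrix.of_apply, hM']
    by_cases h : (i : ℕ) < order Q
    · simp [h]
    · have h' : ¬ (i : ℕ) = i - order Q := by omega
      rw [if_neg h, if_neg h, if_neg h, if_neg h', coeff_C_zero, sub_zero,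
        ← MvPolynomial.algebraMap_eq, ← aeval_dilate, ← coeff_A_pow_mul_top]
      congr 3
      omega
  · intro i j hij
    have hij : i < j := hij
    rw [Matrix.of_apply, hM']
    split_ifs with h h' h'
    · omega
    · simp
    · omega
    · rw [coeff_A_pow_mul_eq_zero _ _ (by omega)]
      simp

/-- The analogue of `coeff_inLambda_eliminant` for `μ`. The additional sign is that of the cyclic
permutation that moves the rows of `Q` above those of `P`. -/
theorem coeff_inMu_eliminant {P Q : QHeis K q} (hP : 1 ≤ order P) :
    (inMu (eliminant P Q)).natDegree ≤ order P ∧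
    (inMu (eliminant P Q)).coeff (order P) =
      (-1) ^ (order P * (order Q + 1)) * ∏ k ∈ Finset.range (order Q),
        Polynomial.aeval (MvPolynomial.C (q ^ k) * MvPolynomial.X 0) (coeff P (order P)) := by
  set M := (eliminantMatrix P Q).map inMu with hM
  have hM' : ∀ i j, M i j = if (i : ℕ) < order Q then
      C (Polynomial.aeval (MvPolynomial.X 0) (coeff (A ^ (i : ℕ) * P) j)
        - (if (j : ℕ) = i then MvPolynomial.X 1 else 0))
    else
      C (Polynomial.aeval (MvPolynomial.X 0) (coeff (A ^ ((i : ℕ) - order Q) * Q) j))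
        - (if (j : ℕ) = (i : ℕ) - order Q then X else 0) := by
    intro i j
    simp only [hM, Matrix.map_apply, eliminantMatrix, Matrix.of_apply]
    split_ifs <;> simp only [map_sub, inMu_aeval_X, map_zero] <;> simp [inMu]
  have hdet : inMu (eliminant P Q) = M.det := AlgHom.map_det _ _
  have hdeg : ∀ i j, (M i j).natDegree ≤ if (i : ℕ) < order Q then 0 else 1 := by
    intro i j
    rw [hM']
    split_ifs
    · simp
    · simp
    · exact (natDegree_sub_le _ _).trans (max_le (by simp) (by simp))
    · exact (natDegree_sub_le _ _).trans (max_le (by simp) (by simp))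
  have hsum : ∑ i : Fin (order P + order Q), (if (i : ℕ) < order Q then 0 else 1) = order P := by
    rw [Fin.sum_univ_ite_lt (add_comm _ _) (fun _ => 0) (fun _ => 1)]
    simp
  have h1 := natDegree_det_le_of_rows M _ hdeg
  have h2 := coeff_det_of_rows M _ hdeg
  rw [hsum] at h1 h2
  rw [hdet]
  refine ⟨h1, ?_⟩
  -- Moving the last `order P` rows to the top makes the matrix of coefficients lower triangular.
  set e : Equiv.Perm (Fin (order P + order Q)) := finCycle ⟨order Q, by omega⟩ with he
  have he' (i) : (e i : ℕ) = if (i : ℕ) < order P then i + order Q else i - order P := by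
    have hi := i.2
    rw [he, finCycle_apply, Fin.val_add]
    split_ifs with h
    · exact Nat.mod_eq_of_lt (by simpa using h)
    · simp only
      rw [Nat.mod_eq_sub_mod (by omega), Nat.mod_eq_of_lt (by omega)]
      omega
  have hsign : ((Equiv.Perm.sign e : ℤ) : MvPolynomial (Fin 2) K) =
      (-1) ^ (order P * order Q) := by
    rw [he, sign_finCycle]
    push_cast
    -- `order Q * (order Q - 1)` is even, so only `order P * order Q` contributes to the sign.
    have hmul : (order P + order Q - 1) * order Q =
        order P * order Q + order Q * (order Q - 1) := by
      rcases Nat.eq_zero_or_pos (order Q) with h0 | h0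
      · simp [h0]
      · rw [Nat.add_sub_assoc h0, add_mul, mul_comm (order Q) (order Q - 1)]
    rw [hmul, pow_add, (Nat.even_mul_pred_self _).neg_one_pow, mul_one]
  set T := Matrix.of fun i j => (M i j).coeff (if (i : ℕ) < order Q then 0 else 1) with hT
  have h3 : T.det = (-1) ^ (order P * order Q) * (T.submatrix e id).det := by
    rw [Matrix.det_permute, hsign, ← mul_assoc, ← mul_pow, neg_one_mul, neg_neg, one_pow, one_mul]
  rw [h2, h3, mul_add, mul_one, pow_add, mul_assoc, Matrix.det_of_isLowerTriangular]
  · congr 1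
    have hc : (-1) ^ order P = ∏ _k ∈ Finset.range (order P),
        (-1 : MvPolynomial (Fin 2) K) := by simp
    rw [hc, ← Fin.prod_univ_ite_lt rfl]
    refine Finset.prod_congr rfl fun i _ => ?_
    have hi := i.2
    rw [Matrix.submatrix_apply, hT, Matrix.of_apply, hM', he', id]
    by_cases h : (i : ℕ) < order P
    · simp [h]
    · have h4 : (i : ℕ) - order P < order Q := by omega
      have h5 : ¬ (i : ℕ) = i - order P := by omega
      simp only [if_neg h]
      rw [if_pos h4, if_pos h4, if_neg h5, coeff_C_zero, sub_zero,
        ← MvPolynomial.algebraMap_eq, ← aeval_dilate, ← coeff_A_pow_mul_top]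
      congr 3
      omega
  · intro i j hij
    have hij : (i : ℕ) < j := hij
    have hi := i.2
    have hj := j.2
    rw [Matrix.submatrix_apply, hT, Matrix.of_apply, hM', he', id]
    by_cases h : (i : ℕ) < order P
    · have h4 : ¬ (j : ℕ) = i := by omega
      simp [h, h4]
    · have h4 : (i : ℕ) - order P < order Q := by omega
      have h5 : ¬ (j : ℕ) = i - order P := by omega
      simp only [if_neg h]
      rw [if_pos h4, if_pos h4, if_neg h5,
        coeff_A_pow_mul_eq_zero _ _ (by omega)]
      simp

theorem prod_aeval_ne_zero (hq : q ≠ 0) {p : K[X]} (hp : p ≠ 0) (m : ℕ) (i : Fin 2) :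
    ∏ k ∈ Finset.range m, Polynomial.aeval
      (MvPolynomial.C (q ^ k) * MvPolynomial.X i : MvPolynomial (Fin 2) K) p ≠ 0 := by
  refine Finset.prod_ne_zero_iff.2 fun k _ => ?_
  rw [← MvPolynomial.algebraMap_eq, ← aeval_dilate]
  exact fun h => dilate_ne_zero (pow_ne_zero k hq) hp
    (transcendental_iff.1 (MvPolynomial.transcendental_X K i) _ h)

theorem inX_eliminantMatrix_apply (P Q : QHeis K q) (i j : Fin (order P + order Q)) :
    inX (eliminantMatrix P Q i j) = if (i : ℕ) < order Q then
      (coeff (A ^ (i : ℕ) * P) j).map MvPolynomial.C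
        - C (if (j : ℕ) = i then MvPolynomial.X 0 else 0)
    else
      (coeff (A ^ ((i : ℕ) - order Q) * Q) j).map MvPolynomial.C
        - C (if (j : ℕ) = (i : ℕ) - order Q then MvPolynomial.X 1 else 0) := by
  simp only [eliminantMatrix, Matrix.of_apply]
  split_ifs <;> simp only [map_sub, inX_aeval_X, map_zero] <;> simp [inX]

theorem natDegree_inX_eliminant_le (P Q : QHeis K q) :
    (inX (eliminant P Q)).natDegree ≤ order Q * maxDeg P + order P * maxDeg Q := by
  have h := natDegree_det_le_of_rows ((eliminantMatrix P Q).map inX)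
    (fun i => if (i : ℕ) < order Q then maxDeg P else maxDeg Q) (fun i j => by
      rw [Matrix.map_apply, inX_eliminantMatrix_apply]
      split_ifs <;> exact (natDegree_sub_le _ _).trans (max_le
        (natDegree_map_le.trans (natDegree_coeff_A_pow_mul_le _ _ _)) (by simp)))
  rw [Fin.sum_univ_ite_lt (add_comm _ _) (fun _ => maxDeg P) (fun _ => maxDeg Q)] at h
  rw [eliminant, AlgHom.map_det]
  simpa using h

/-! ### The coefficients of the eliminant as polynomials in `q` -/

/-- The elements of `K` that are values at `q` of polynomials of degree at most `t` over `R`. -/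
def polyValues (R : Subring K) (q : K) (t : ℕ) : AddSubgroup K where
  carrier := {c | ∃ f : R[X], f.natDegree ≤ t ∧ Polynomial.aeval q f = c}
  add_mem' := by
    rintro _ _ ⟨f, hf, rfl⟩ ⟨g, hg, rfl⟩
    exact ⟨f + g, natDegree_add_le_of_degree_le hf hg, map_add _ _ _⟩
  zero_mem' := ⟨0, by simp, map_zero _⟩
  neg_mem' := by
    rintro _ ⟨f, hf, rfl⟩
    exact ⟨-f, by rwa [natDegree_neg], map_neg _ _⟩

theorem polyValues_mono {R : Subring K} {a b : ℕ} (h : a ≤ b) :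
    polyValues R q a ≤ polyValues R q b := by
  rintro _ ⟨f, hf, rfl⟩
  exact ⟨f, hf.trans h, rfl⟩

theorem mul_mem_polyValues {R : Subring K} {a b : ℕ} {x y : K} (hx : x ∈ polyValues R q a)
    (hy : y ∈ polyValues R q b) : x * y ∈ polyValues R q (a + b) := by
  obtain ⟨f, hf, rfl⟩ := hx
  obtain ⟨g, hg, rfl⟩ := hy
  exact ⟨f * g, natDegree_mul_le_of_le hf hg, map_mul _ _ _⟩

theorem mem_polyValues_zero {R : Subring K} {x : K} (hx : x ∈ R) : x ∈ polyValues R q 0 :=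
  ⟨C ⟨x, hx⟩, by simp, (Polynomial.aeval_C q _).trans rfl⟩

theorem pow_mem_polyValues (R : Subring K) (i : ℕ) : q ^ i ∈ polyValues R q i :=
  ⟨X ^ i, by simp, by simp⟩

theorem coeff_dilate_mem {R : Subring K} {f : K[X]} {a D : ℕ} (hD : f.natDegree ≤ D)
    (h : ∀ i, f.coeff i ∈ polyValues R q a) (i : ℕ) :
    (dilate q f).coeff i ∈ polyValues R q (a + D) := by
  rw [coeff_dilate]
  by_cases hi : i ≤ D
  · rw [add_comm]
    exact mul_mem_polyValues (polyValues_mono hi (pow_mem_polyValues R i)) (h i)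
  · rw [coeff_eq_zero_of_natDegree_lt (by omega), mul_zero]
    exact zero_mem _

theorem coeff_qDeriv_mem {R : Subring K} {f : K[X]} {a D : ℕ} (hD : f.natDegree ≤ D)
    (h : ∀ i, f.coeff i ∈ polyValues R q a) (i : ℕ) :
    (qDeriv q f).coeff i ∈ polyValues R q (a + D) := by
  rw [coeff_qDeriv]
  by_cases hi : i ≤ D
  · rw [add_comm a]
    refine mul_mem_polyValues (sum_mem fun l hl => polyValues_mono ?_ (pow_mem_polyValues R l))
      (h _)
    exact (Nat.lt_succ_iff.1 (Finset.mem_range.1 hl)).trans hi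
  · rw [coeff_eq_zero_of_natDegree_lt (by omega), mul_zero]
    exact zero_mem _

/-- Each left multiplication with `A` raises the degree in `q` by at most `maxDeg P`, since the
coefficients have degree at most `maxDeg P` in `X`. -/
theorem coeff_A_pow_mul_mem {R : Subring K} {P : QHeis K q}
    (hR : ∀ j i, (coeff P j).coeff i ∈ R) (k j i : ℕ) :
    (coeff (A ^ k * P) j).coeff i ∈ polyValues R q (k * maxDeg P) := by
  induction k generalizing j i with
  | zero =>
    rw [pow_zero, one_mul, zero_mul]
    exact mem_polyValues_zero (hR j i)
  | succ k ih =>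
    rw [pow_succ', mul_assoc, coeff_A_mul, Polynomial.coeff_add, Nat.succ_mul]
    refine add_mem ?_ (coeff_qDeriv_mem (natDegree_coeff_A_pow_mul_le P k j) (ih j) i)
    rcases j with _ | j
    · rw [coeff_mul_A_zero, map_zero, Polynomial.coeff_zero]
      exact zero_mem _
    · rw [coeff_mul_A_succ]
      exact coeff_dilate_mem (natDegree_coeff_A_pow_mul_le P k j) (ih j) i

/-- The elements of `K[λ, μ][X]` with coefficients in `polyValues R q t`. -/
def polysOverValues (R : Subring K) (q : K) (t : ℕ) :
    AddSubgroup (Polynomial (MvPolynomial (Fin 2) K)) where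
  carrier := {f | ∀ i d, (f.coeff i).coeff d ∈ polyValues R q t}
  add_mem' hf hg i d := by
    rw [Polynomial.coeff_add, MvPolynomial.coeff_add]
    exact add_mem (hf i d) (hg i d)
  zero_mem' i d := by
    rw [Polynomial.coeff_zero, MvPolynomial.coeff_zero]
    exact zero_mem _
  neg_mem' hf i d := by
    rw [Polynomial.coeff_neg, MvPolynomial.coeff_neg]
    exact neg_mem (hf i d)

theorem mul_mem_polysOverValues {R : Subring K} {a b : ℕ}
    {f g : Polynomial (MvPolynomial (Fin 2) K)} (hf : f ∈ polysOverValues R q a)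
    (hg : g ∈ polysOverValues R q b) : f * g ∈ polysOverValues R q (a + b) := by
  intro i d
  rw [Polynomial.coeff_mul, MvPolynomial.coeff_sum]
  refine sum_mem fun x _ => ?_
  rw [MvPolynomial.coeff_mul]
  exact sum_mem fun y _ => mul_mem_polyValues (hf _ _) (hg _ _)

theorem C_mem_polysOverValues {R : Subring K} {t : ℕ} {f : MvPolynomial (Fin 2) K}
    (hf : ∀ d, f.coeff d ∈ R) : C f ∈ polysOverValues R q t := by
  intro i d
  rw [coeff_C]
  split_ifs
  · exact polyValues_mono (Nat.zero_le t) (mem_polyValues_zero (hf d))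
  · rw [MvPolynomial.coeff_zero]
    exact zero_mem _

theorem map_C_mem_polysOverValues {R : Subring K} {t : ℕ} {f : K[X]}
    (hf : ∀ i, f.coeff i ∈ polyValues R q t) : f.map MvPolynomial.C ∈ polysOverValues R q t := by
  classical
  intro i d
  rw [Polynomial.coeff_map, MvPolynomial.coeff_C]
  split_ifs
  · exact hf i
  · exact zero_mem _

theorem coeff_ite_X_mem (R : Subring K) (c : Prop) [Decidable c] (a : Fin 2) (d : Fin 2 →₀ ℕ) :
    (if c then MvPolynomial.X a else 0 : MvPolynomial (Fin 2) K).coeff d ∈ R := by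
  classical
  split_ifs
  · rw [MvPolynomial.coeff_X]
    split_ifs
    exacts [one_mem R, zero_mem R]
  · rw [MvPolynomial.coeff_zero]
    exact zero_mem R

/-- Row `k` of the eliminant matrix of `P` has degree at most `k * maxDeg P` in `q`, and similarly
for `Q`; the bound is the sum of these degrees over all rows. -/
theorem coeff_delta_mem {R : Subring K} {P Q : QHeis K q} (hR : coeffRing P Q ≤ R) (i : ℕ)
    (d : Fin 2 →₀ ℕ) : (delta P Q i).coeff d ∈ polyValues R q
      (order Q * (order Q - 1) / 2 * maxDeg P + order P * (order P - 1) / 2 * maxDeg Q) := by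
  have hP : ∀ j i, (coeff P j).coeff i ∈ R := fun j i =>
    hR (Subring.subset_closure ⟨j, i, Or.inl rfl⟩)
  have hQ : ∀ j i, (coeff Q j).coeff i ∈ R := fun j i =>
    hR (Subring.subset_closure ⟨j, i, Or.inr rfl⟩)
  have h := Matrix.det_mem_of_forall_row_mem (polysOverValues R q)
    (C_mem_polysOverValues (f := 1) fun d => by
      classical
      rw [MvPolynomial.coeff_one]
      split_ifs
      exacts [one_mem R, zero_mem R])
    (fun a b x y hx hy => mul_mem_polysOverValues hx hy) ((eliminantMatrix P Q).map inX)
    (fun i => if (i : ℕ) < order Q then i * maxDeg P else (i - order Q) * maxDeg Q)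
    (fun i j => by
      rw [Matrix.map_apply, inX_eliminantMatrix_apply]
      by_cases h : (i : ℕ) < order Q
      · rw [if_pos h, if_pos h]
        exact sub_mem (map_C_mem_polysOverValues (coeff_A_pow_mul_mem hP _ _))
          (C_mem_polysOverValues (coeff_ite_X_mem R _ _))
      · rw [if_neg h, if_neg h]
        exact sub_mem (map_C_mem_polysOverValues (coeff_A_pow_mul_mem hQ _ _))
          (C_mem_polysOverValues (coeff_ite_X_mem R _ _)))
  rw [Fin.sum_univ_ite_lt (add_comm _ _) (fun k => k * maxDeg P) (fun l => l * maxDeg Q),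
    ← Finset.sum_mul, ← Finset.sum_mul, Finset.sum_range_id, Finset.sum_range_id] at h
  rw [delta, eliminant, AlgHom.map_det]
  exact h i d

theorem mem_adjoin_of_mem_polyValues {R : Subring K} {t : ℕ} {c : K} (h : c ∈ polyValues R q t) :
    c ∈ Algebra.adjoin R {q} ∧
      ∃ r : ℕ → R, c = ∑ l ∈ Finset.range (t + 1), (r l : K) * q ^ l := by
  obtain ⟨f, hf, rfl⟩ := h
  refine ⟨aeval_mem_adjoin_singleton R q, f.coeff, ?_⟩
  rw [aeval_eq_sum_range' (Nat.lt_succ_of_le hf)]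
  rfl

end QHeis

theorem theorem2p4 {K : Type*} [Field K] (q : K) (hq : q ≠ 0)
    (hqInt : ∀ n : ℤ, qInt q n = 0 ↔ n = 0)
    (P Q : QHeis K q) (hPQ : Commute P Q) (m n : ℕ)
    (hm : 1 ≤ m) (hn : 1 ≤ n) (hPm : P.order = m) (hQn : Q.order = n)
    (s t : ℕ) (hs : s = n * P.maxDeg + m * Q.maxDeg)
    (ht : t = n * (n - 1) / 2 * P.maxDeg + m * (m - 1) / 2 * Q.maxDeg) :
    QHeis.eliminant P Q ≠ 0 ∧
    -- degree and leading coefficient in `K[X, μ][λ]`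
    ((QHeis.inLambda (QHeis.eliminant P Q)).natDegree = n ∧
      (QHeis.inLambda (QHeis.eliminant P Q)).coeff n ≠ 0 ∧
      (QHeis.inLambda (QHeis.eliminant P Q)).coeff n =
        (-1) ^ n * ∏ k ∈ Finset.range m,
          Polynomial.aeval (MvPolynomial.C (q ^ k) * MvPolynomial.X 0) (Q.coeff n)) ∧
    -- degree and leading coefficient in `K[X, λ][μ]`
    ((QHeis.inMu (QHeis.eliminant P Q)).natDegree = m ∧
      (QHeis.inMu (QHeis.eliminant P Q)).coeff m ≠ 0 ∧
      (QHeis.inMu (QHeis.eliminant P Q)).coeff m =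
        (-1) ^ (m * (n + 1)) * ∏ k ∈ Finset.range n,
          Polynomial.aeval (MvPolynomial.C (q ^ k) * MvPolynomial.X 0) (P.coeff m)) ∧
    -- degree in `K[λ, μ][X]`
    (QHeis.inX (QHeis.eliminant P Q)).natDegree ≤ s ∧
    -- the coefficients of the `δ_i`
    (∀ R : Subring K, QHeis.coeffRing P Q ≤ R → ∀ i ≤ s, ∀ d : Fin 2 →₀ ℕ,
      (QHeis.delta P Q i).coeff d ∈ Algebra.adjoin R {q} ∧
      ∃ r : ℕ → R, (QHeis.delta P Q i).coeff d
        = ∑ l ∈ Finset.range (t + 1), (r l : K) * q ^ l) ∧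
    (∃ i ≤ s, QHeis.delta P Q i ≠ 0) ∧
    (∀ i ≤ s, QHeis.evalAt (QHeis.delta P Q i) P Q = 0) := by
  subst hPm hQn hs ht
  have hne {R : QHeis K q} (hR : 1 ≤ R.order) : R.coeff R.order ≠ 0 := by
    refine QHeis.coeff_order_ne_zero ?_
    rintro rfl
    simp [QHeis.order] at hR
  obtain ⟨hl1, hl2⟩ := QHeis.coeff_inLambda_eliminant (P := P) hn
  obtain ⟨hu1, hu2⟩ := QHeis.coeff_inMu_eliminant (Q := Q) hm
  have hl0 : (QHeis.inLambda (QHeis.eliminant P Q)).coeff Q.order ≠ 0 := by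
    rw [hl2]
    exact mul_ne_zero (pow_ne_zero _ (neg_ne_zero.2 one_ne_zero))
      (QHeis.prod_aeval_ne_zero hq (hne hn) _ _)
  have hu0 : (QHeis.inMu (QHeis.eliminant P Q)).coeff P.order ≠ 0 := by
    rw [hu2]
    exact mul_ne_zero (pow_ne_zero _ (neg_ne_zero.2 one_ne_zero))
      (QHeis.prod_aeval_ne_zero hq (hne hm) _ _)
  have h0 : QHeis.eliminant P Q ≠ 0 := fun h => hl0 (by rw [h, map_zero, Polynomial.coeff_zero])
  have hX := QHeis.natDegree_inX_eliminant_le P Q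
  refine ⟨h0, ⟨hl1.antisymm (Polynomial.le_natDegree_of_ne_zero hl0), hl0, hl2⟩,
    ⟨hu1.antisymm (Polynomial.le_natDegree_of_ne_zero hu0), hu0, hu2⟩, hX,
    fun R hR i _ d => QHeis.mem_adjoin_of_mem_polyValues (QHeis.coeff_delta_mem hR i d),
    ⟨_, hX, ?_⟩, fun i hi => ?_⟩
  · rw [QHeis.delta, Polynomial.coeff_natDegree, Polynomial.leadingCoeff_ne_zero]
    exact (map_ne_zero_iff _ QHeis.inX_injective).2 h0
  · exact QHeis.eq_zero_of_sum_B_pow_mul_eq_zero hq hqInt hm _ _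
      (fun i _ => QHeis.commute_evalAt hPQ _) (QHeis.sum_B_pow_mul_evalAt_delta hm hPQ hX) i
      (Finset.mem_range.2 (Nat.lt_succ_of_le hi))
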